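/- An involutive (commutative) residuated lattice (IRL) is an algebra $\mathbf A=\langle A;\cdot,\wedge,\vee,\neg,e\rangle$ such that $\langle A;\cdot,e\rangle$ is a commutative monoid, $\langle A;\wedge,\vee\rangle$ is a lattice (with order $\leqslant$), $\neg\neg x=x$ for all $x$, and $x\cdot y\leqslant z\iff \neg z\cdot y\leqslant\neg x$ for all $x,y,z$. Homomorphisms and subalgebras are understood with respect to these five operations. A De Morgan monoid is an IRL whose lattice reduct is distributive and which satisfies $x\leqslant x\cdot x$. An IRL is semilinear if it is isomorphic to a subdirect product of totally ordered IRLs, and negatively generated if it is generated, as an algebra, by $\{a\in A: a\leqslant e\}$. A variety is a class of similar algebras closed under homomorphic images, subalgebras and direct products. For a class $\mathsf K$ of similar algebras, a homomorphism $f\colon\mathbf A\to\mathbf B$ with $\mathbf A,\mathbf B\in\mathsf K$ is a $\mathsf K$-epimorphism if, for all $\mathbf C\in\mathsf K$ and all homomorphisms $g,h\colon\mathbf B\to\mathbf C$, $g\circ f=h\circ f$ implies $g=h$; and $\mathsf K$ has surjective epimorphisms if every $\mathsf K$-epimorphism is surjective. **Theorem.** Let $\mathsf K$ be any variety of De Morgan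 monoids all of whose members are semilinear and negatively generated. Then $\mathsf K$ has surjective epimorphisms. -/

import Mathlib

universe u v

/-- An involutive (commutative) residuated lattice `⟨A; *, ⊓, ⊔, -, 1⟩`: a commutative monoid
(fusion `*`, neutral element `1`, written `e` on paper) and a lattice, with an involution `-`
(written `¬` on paper) such that `x * y ≤ z ↔ -z * y ≤ -x`. -/
class InvolutiveResiduatedLattice (A : Type u) extends CommMonoid A, Lattice A, InvolutiveNeg A where
  mul_le_iff : ∀ x y z : A, x * y ≤ z ↔ -z * y ≤ -x

namespace InvolutiveResiduatedLattice

/-- Homomorphisms: maps that preserve all five basic operations. -/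
@[ext]
structure Hom (A : Type u) (B : Type v) [InvolutiveResiduatedLattice A]
    [InvolutiveResiduatedLattice B] where
  toFun : A → B
  map_mul : ∀ x y, toFun (x * y) = toFun x * toFun y
  map_inf : ∀ x y, toFun (x ⊓ y) = toFun x ⊓ toFun y
  map_sup : ∀ x y, toFun (x ⊔ y) = toFun x ⊔ toFun y
  map_neg : ∀ x, toFun (-x) = -toFun x
  map_one : toFun 1 = 1

instance (A : Type u) (B : Type v) [InvolutiveResiduatedLattice A]
    [InvolutiveResiduatedLattice B] : CoeFun (Hom A B) (fun _ => A → B) :=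
  ⟨Hom.toFun⟩

/-- The direct product, with the pointwise operations (and hence the pointwise order). -/
instance pi {ι : Type v} (A : ι → Type u) [∀ i, InvolutiveResiduatedLattice (A i)] :
    InvolutiveResiduatedLattice (∀ i, A i) where
  mul_le_iff _ _ _ := forall_congr' fun _ => mul_le_iff _ _ _

/-- `S` is the universe of a subalgebra of `A`. -/
structure IsSubuniverse {A : Type u} [InvolutiveResiduatedLattice A] (S : Set A) : Prop where
  mul_mem : ∀ x ∈ S, ∀ y ∈ S, x * y ∈ S
  inf_mem : ∀ x ∈ S, ∀ y ∈ S, x ⊓ y ∈ S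
  sup_mem : ∀ x ∈ S, ∀ y ∈ S, x ⊔ y ∈ S
  neg_mem : ∀ x ∈ S, -x ∈ S
  one_mem : (1 : A) ∈ S

/-- The universe of the subalgebra generated by `X`. -/
def sg {A : Type u} [InvolutiveResiduatedLattice A] (X : Set A) : Set A :=
  ⋂₀ {S : Set A | IsSubuniverse S ∧ X ⊆ S}

/-- `A` is generated by its negative elements, that is, by the lower bounds of `1`. -/
def NegativelyGenerated (A : Type u) [InvolutiveResiduatedLattice A] : Prop :=
  sg {a : A | a ≤ 1} = Set.univ

/-- `A` is isomorphic to a subdirect product of totally ordered algebras. -/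
def Semilinear (A : Type u) [InvolutiveResiduatedLattice A] : Prop :=
  ∃ (ι : Type u) (T : ι → Type u) (_ : ∀ i, InvolutiveResiduatedLattice (T i)),
    (∀ i, ∀ x y : T i, x ≤ y ∨ y ≤ x) ∧
    ∃ f : Hom A (∀ i, T i),
      Function.Injective f ∧ ∀ i, Function.Surjective fun a => f a i

/-- De Morgan monoids: distributive and square-increasing. -/
structure IsDeMorganMonoid (A : Type u) [InvolutiveResiduatedLattice A] : Prop where
  inf_sup_distrib : ∀ x y z : A, x ⊓ (y ⊔ z) = (x ⊓ y) ⊔ (x ⊓ z)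
  le_mul_self : ∀ x : A, x ≤ x * x

/-- A class of algebras is a variety if it is closed under homomorphic images, (isomorphic copies
of) subalgebras, and direct products. -/
structure IsVariety (K : (A : Type u) → [InvolutiveResiduatedLattice A] → Prop) : Prop where
  image : ∀ (A B : Type u) [InvolutiveResiduatedLattice A] [InvolutiveResiduatedLattice B]
    (f : Hom A B), Function.Surjective f → K A → K B
  subalgebra : ∀ (A B : Type u) [InvolutiveResiduatedLattice A] [InvolutiveResiduatedLattice B]
    (f : Hom A B), Function.Injective f → K B → K A
  prod : ∀ (ι : Type u) (A : ι → Type u) [∀ i, InvolutiveResiduatedLattice (A i)],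
    (∀ i, K (A i)) → K (∀ i, A i)

/-- Epimorphisms of the class `K`: homomorphisms `f` that are right-cancellable with respect to
homomorphisms into members of `K`. -/
def IsEpimorphism (K : (A : Type u) → [InvolutiveResiduatedLattice A] → Prop)
    {A B : Type u} [InvolutiveResiduatedLattice A] [InvolutiveResiduatedLattice B]
    (f : Hom A B) : Prop :=
  ∀ (C : Type u) [InvolutiveResiduatedLattice C], K C →
    ∀ g h : Hom B C, (g : B → C) ∘ f = (h : B → C) ∘ f → g = h

/-- The epimorphism-surjectivity (ES) property of a class `K`. -/
def HasSurjectiveEpimorphisms (K : (A : Type u) → [InvolutiveResiduatedLattice A] → Prop) : Prop :=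
  ∀ (A B : Type u) [InvolutiveResiduatedLattice A] [InvolutiveResiduatedLattice B],
    K A → K B → ∀ f : Hom A B, IsEpimorphism K f → Function.Surjective f

end InvolutiveResiduatedLattice

/-! Suppose a `K`-epimorphism `f` from `A` to `B` is not onto. As `B` is negatively generated, some
`b ≤ 1` lies outside `f(A)`. Prime ideals of the distributive lattice `B` yield deductive filters
with totally ordered quotients (`exists_isLinear_disjoint`). Choose such a filter `F` containing `b`
but no `f a ≤ b`, then such a `G` containing `f(A) ∩ F` but not `b`. If `A → B/F` is onto, then `[f
a]_F ↦ [f a]_G` is a homomorphism `B/F → B/G`. Composed with `B → B/F`, it agrees with the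
projection to `B/G` on `f(A)` but not at `b`, a contradiction.

Since `A → B/F` is again an epimorphism, it remains to treat totally ordered codomains
(`IsEpimorphism.surjective_of_chain`). Collapsing all `f a > b` to `1` makes `b` larger than every
image element below `1`; then `exists_endomorphism_of_lt` gives an endomorphism fixing the image and
sending `b` to `1`, although `b` is not `1`.

That endomorphism rests on the arithmetic of De Morgan chains: suitable sets `J` of negative
elements generate subalgebras consisting of `x`, `-x`, `x * -1` and `star x` for `x ∈ J`, with no
new negative elements. A filter that meets `J` only in `1` and covers the rest of the negative cone
then has `span J` as a transversal. -/

namespace InvolutiveResiduatedLattice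

/-! ### Residuation -/

section Basic

variable {A : Type u} [InvolutiveResiduatedLattice A] {x y z w : A}

/-- The residual `x → y`. -/
def imp (x y : A) : A := -(x * -y)

theorem neg_le_neg_iff' : -x ≤ -y ↔ y ≤ x := by
  simpa using (mul_le_iff y 1 x).symm

theorem neg_le_comm : -x ≤ y ↔ -y ≤ x := by
  rw [← neg_le_neg_iff', neg_neg]

theorem le_neg_comm : x ≤ -y ↔ y ≤ -x := by
  rw [← neg_le_neg_iff', neg_neg]

theorem le_imp_iff : z ≤ imp x y ↔ z * x ≤ y := by
  rw [imp, le_neg_comm, mul_le_iff z, mul_comm]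

theorem mul_le_neg_one_iff : x * y ≤ -1 ↔ x ≤ -y := by
  rw [mul_le_iff, neg_neg, one_mul, le_neg_comm]

theorem imp_mul_le : imp x y * x ≤ y := le_imp_iff.1 le_rfl

theorem mul_mono_left (h : x ≤ y) (z : A) : x * z ≤ y * z :=
  le_imp_iff.1 (h.trans (le_imp_iff.2 le_rfl))

theorem mul_mono (h : x ≤ y) (h' : z ≤ w) : x * z ≤ y * w := by
  refine (mul_mono_left h z).trans ?_
  rw [mul_comm y, mul_comm y]
  exact mul_mono_left h' y

theorem mul_le_of_le_one_left (h : x ≤ 1) : x * y ≤ y := by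
  simpa using mul_mono_left h y

theorem mul_le_of_le_one_right (h : x ≤ 1) : y * x ≤ y := by
  simpa [mul_comm] using mul_mono_left h y

theorem le_mul_of_one_le_left (h : 1 ≤ x) : y ≤ x * y := by
  simpa using mul_mono_left h y

theorem le_mul_of_one_le_right (h : 1 ≤ x) : y ≤ y * x := by
  simpa [mul_comm] using mul_mono_left h y

theorem one_le_imp_iff : 1 ≤ imp x y ↔ x ≤ y := by
  rw [le_imp_iff, one_mul]

theorem imp_one_left : imp 1 x = x := by simp [imp]

theorem imp_mul_imp_le : imp x y * imp y z ≤ imp x z := by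
  rw [le_imp_iff, mul_comm (imp x y), mul_assoc]
  refine le_trans (mul_mono le_rfl imp_mul_le) imp_mul_le

theorem imp_le_imp_mul : imp x y ≤ imp (x * z) (y * z) := by
  rw [le_imp_iff, ← mul_assoc]
  exact mul_mono_left imp_mul_le z

theorem imp_neg_neg : imp (-x) (-y) = imp y x := by
  simp [imp, mul_comm]

/-- The meet with `1` keeps the factor from enlarging `z`. Filters contain `1` and are closed under
meets, so it costs nothing when passing to congruences. -/
theorem imp_inf_one_le_imp_inf : imp x y ⊓ 1 ≤ imp (x ⊓ z) (y ⊓ z) := by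
  rw [le_imp_iff]
  refine le_inf ((mul_mono inf_le_left inf_le_left).trans imp_mul_le) ?_
  exact (mul_le_of_le_one_left inf_le_right).trans inf_le_right

theorem imp_inf_one_le_imp_sup : imp x y ⊓ 1 ≤ imp (x ⊔ z) (y ⊔ z) := by
  rw [le_imp_iff, mul_comm, ← le_imp_iff]
  refine sup_le (le_imp_iff.2 ?_) (le_imp_iff.2 ?_)
  · rw [mul_comm]
    exact ((mul_mono_left inf_le_left _).trans imp_mul_le).trans le_sup_left
  · exact (mul_le_of_le_one_right inf_le_right).trans le_sup_right

theorem IsSubuniverse.imp_mem {S : Set A} (hS : IsSubuniverse S) (hx : x ∈ S) (hy : y ∈ S) :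
    imp x y ∈ S :=
  hS.neg_mem _ (hS.mul_mem _ hx _ (hS.neg_mem _ hy))

theorem NegativelyGenerated.eq_univ (hA : NegativelyGenerated A) {S : Set A}
    (hS : IsSubuniverse S) (h : ∀ a ≤ 1, a ∈ S) : S = Set.univ := by
  rw [Set.eq_univ_iff_forall]
  intro a
  have ha : a ∈ sg {a : A | a ≤ 1} := hA ▸ Set.mem_univ a
  exact ha S ⟨hS, h⟩

end Basic

namespace Hom

variable {A : Type u} {B : Type v} [InvolutiveResiduatedLattice A] [InvolutiveResiduatedLattice B]

theorem map_imp (f : Hom A B) (x y : A) : f (imp x y) = imp (f x) (f y) := by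
  simp [imp, f.map_neg, f.map_mul]

theorem mono (f : Hom A B) {x y : A} (h : x ≤ y) : f x ≤ f y := by
  rw [← inf_eq_left, ← f.map_inf, inf_eq_left.2 h]

theorem isSubuniverse_range (f : Hom A B) : IsSubuniverse (Set.range f) where
  mul_mem := by rintro _ ⟨x, rfl⟩ _ ⟨y, rfl⟩; exact ⟨x * y, f.map_mul x y⟩
  inf_mem := by rintro _ ⟨x, rfl⟩ _ ⟨y, rfl⟩; exact ⟨x ⊓ y, f.map_inf x y⟩
  sup_mem := by rintro _ ⟨x, rfl⟩ _ ⟨y, rfl⟩; exact ⟨x ⊔ y, f.map_sup x y⟩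
  neg_mem := by rintro _ ⟨x, rfl⟩; exact ⟨-x, f.map_neg x⟩
  one_mem := ⟨1, f.map_one⟩

theorem isSubuniverse_preimage (f : Hom A B) {S : Set B} (hS : IsSubuniverse S) :
    IsSubuniverse (f ⁻¹' S) where
  mul_mem x hx y hy := by simpa [f.map_mul] using hS.mul_mem _ hx _ hy
  inf_mem x hx y hy := by simpa [f.map_inf] using hS.inf_mem _ hx _ hy
  sup_mem x hx y hy := by simpa [f.map_sup] using hS.sup_mem _ hx _ hy
  neg_mem x hx := by simpa [f.map_neg] using hS.neg_mem _ hx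
  one_mem := by simpa [f.map_one] using hS.one_mem

/-- The identity homomorphism. -/
def id (A : Type u) [InvolutiveResiduatedLattice A] : Hom A A :=
  ⟨fun x => x, fun _ _ => rfl, fun _ _ => rfl, fun _ _ => rfl, fun _ => rfl, rfl⟩

/-- Composition of homomorphisms. -/
def comp {C : Type*} [InvolutiveResiduatedLattice C] (g : Hom B C) (f : Hom A B) : Hom A C where
  toFun x := g (f x)
  map_mul x y := by simp [f.map_mul, g.map_mul]
  map_inf x y := by simp [f.map_inf, g.map_inf]
  map_sup x y := by simp [f.map_sup, g.map_sup]
  map_neg x := by simp [f.map_neg, g.map_neg]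
  map_one := by simp [f.map_one, g.map_one]

theorem surjective_of_negative {f : Hom A B} (hB : NegativelyGenerated B)
    (h : ∀ b ≤ 1, b ∈ Set.range f) : Function.Surjective f :=
  Set.range_eq_univ.1 (hB.eq_univ f.isSubuniverse_range h)

end Hom

/-! ### Deductive filters and quotients -/

/-- Deductive filters: the classes `{x | [1] ≤ [x]}` of congruences. -/
structure DeductiveFilter (A : Type u) [InvolutiveResiduatedLattice A] where
  carrier : Set A
  one_mem : 1 ∈ carrier
  inf_mem : ∀ {x y}, x ∈ carrier → y ∈ carrier → x ⊓ y ∈ carrier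
  mul_mem : ∀ {x y}, x ∈ carrier → y ∈ carrier → x * y ∈ carrier
  mem_of_le : ∀ {x y}, x ≤ y → x ∈ carrier → y ∈ carrier

namespace DeductiveFilter

variable {A : Type u} [InvolutiveResiduatedLattice A] (F : DeductiveFilter A)

/-- The congruence of a deductive filter. -/
def setoid : Setoid A where
  r x y := imp x y ∈ F.carrier ∧ imp y x ∈ F.carrier
  iseqv :=
    { refl := fun _ => ⟨F.mem_of_le (one_le_imp_iff.2 le_rfl) F.one_mem,
        F.mem_of_le (one_le_imp_iff.2 le_rfl) F.one_mem⟩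
      symm := fun h => ⟨h.2, h.1⟩
      trans := fun h h' => ⟨F.mem_of_le imp_mul_imp_le (F.mul_mem h.1 h'.1),
        F.mem_of_le imp_mul_imp_le (F.mul_mem h'.2 h.2)⟩ }

/-- The quotient algebra by a deductive filter. -/
def Quot : Type u := Quotient F.setoid

variable {F}

/-- The class of an element in the quotient. -/
def cls (F : DeductiveFilter A) (x : A) : F.Quot := Quotient.mk F.setoid x

theorem cls_eq {x y : A} : F.cls x = F.cls y ↔ imp x y ∈ F.carrier ∧ imp y x ∈ F.carrier :=
  Quotient.eq (r := F.setoid)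

theorem cls_surjective : Function.Surjective F.cls := Quotient.mk_surjective

theorem cls_mul_congr {x x' y y' : A} (h : F.cls x = F.cls x') (h' : F.cls y = F.cls y') :
    F.cls (x * y) = F.cls (x' * y') := by
  have key : ∀ {a b : A} (c : A), F.cls a = F.cls b → F.cls (a * c) = F.cls (b * c) := by
    intro a b c hab
    rw [cls_eq] at hab ⊢
    exact ⟨F.mem_of_le imp_le_imp_mul hab.1, F.mem_of_le imp_le_imp_mul hab.2⟩
  rw [key y h, mul_comm, key x' h', mul_comm]

theorem cls_inf_congr {x x' y y' : A} (h : F.cls x = F.cls x') (h' : F.cls y = F.cls y') :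
    F.cls (x ⊓ y) = F.cls (x' ⊓ y') := by
  have key : ∀ {a b : A} (c : A), F.cls a = F.cls b → F.cls (a ⊓ c) = F.cls (b ⊓ c) := by
    intro a b c hab
    rw [cls_eq] at hab ⊢
    exact ⟨F.mem_of_le imp_inf_one_le_imp_inf (F.inf_mem hab.1 F.one_mem),
      F.mem_of_le imp_inf_one_le_imp_inf (F.inf_mem hab.2 F.one_mem)⟩
  rw [key y h, inf_comm, key x' h', inf_comm]

theorem cls_sup_congr {x x' y y' : A} (h : F.cls x = F.cls x') (h' : F.cls y = F.cls y') :
    F.cls (x ⊔ y) = F.cls (x' ⊔ y') := by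
  have key : ∀ {a b : A} (c : A), F.cls a = F.cls b → F.cls (a ⊔ c) = F.cls (b ⊔ c) := by
    intro a b c hab
    rw [cls_eq] at hab ⊢
    exact ⟨F.mem_of_le imp_inf_one_le_imp_sup (F.inf_mem hab.1 F.one_mem),
      F.mem_of_le imp_inf_one_le_imp_sup (F.inf_mem hab.2 F.one_mem)⟩
  rw [key y h, sup_comm, key x' h', sup_comm]

theorem cls_neg_congr {x x' : A} (h : F.cls x = F.cls x') : F.cls (-x) = F.cls (-x') := by
  rw [cls_eq] at h ⊢
  simpa [imp_neg_neg, and_comm] using h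

instance : Mul F.Quot :=
  ⟨Quotient.lift₂ (fun x y => F.cls (x * y)) fun _ _ _ _ h h' =>
    cls_mul_congr (Quotient.sound h) (Quotient.sound h')⟩

instance : Min F.Quot :=
  ⟨Quotient.lift₂ (fun x y => F.cls (x ⊓ y)) fun _ _ _ _ h h' =>
    cls_inf_congr (Quotient.sound h) (Quotient.sound h')⟩

instance : Max F.Quot :=
  ⟨Quotient.lift₂ (fun x y => F.cls (x ⊔ y)) fun _ _ _ _ h h' =>
    cls_sup_congr (Quotient.sound h) (Quotient.sound h')⟩

instance : Neg F.Quot :=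
  ⟨Quotient.lift (fun x => F.cls (-x)) fun _ _ h => cls_neg_congr (Quotient.sound h)⟩

instance : One F.Quot := ⟨F.cls 1⟩

theorem cls_mul (x y : A) : F.cls (x * y) = F.cls x * F.cls y := rfl
theorem cls_inf (x y : A) : F.cls (x ⊓ y) = F.cls x ⊓ F.cls y := rfl
theorem cls_sup (x y : A) : F.cls (x ⊔ y) = F.cls x ⊔ F.cls y := rfl
theorem cls_neg (x : A) : F.cls (-x) = -F.cls x := rfl

instance : CommMonoid F.Quot where
  mul_assoc := by
    intro a b c
    obtain ⟨x, rfl⟩ := cls_surjective a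
    obtain ⟨y, rfl⟩ := cls_surjective b
    obtain ⟨z, rfl⟩ := cls_surjective c
    simp only [← cls_mul, mul_assoc]
  one_mul := by
    intro a
    obtain ⟨x, rfl⟩ := cls_surjective a
    exact congrArg F.cls (one_mul x)
  mul_one := by
    intro a
    obtain ⟨x, rfl⟩ := cls_surjective a
    exact congrArg F.cls (mul_one x)
  mul_comm := by
    intro a b
    obtain ⟨x, rfl⟩ := cls_surjective a
    obtain ⟨y, rfl⟩ := cls_surjective b
    simp only [← cls_mul, mul_comm]

instance : Lattice F.Quot :=
  Lattice.mk'
    (by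
      intro a b
      obtain ⟨x, rfl⟩ := cls_surjective a
      obtain ⟨y, rfl⟩ := cls_surjective b
      simp only [← cls_sup, sup_comm])
    (by
      intro a b c
      obtain ⟨x, rfl⟩ := cls_surjective a
      obtain ⟨y, rfl⟩ := cls_surjective b
      obtain ⟨z, rfl⟩ := cls_surjective c
      simp only [← cls_sup, sup_assoc])
    (by
      intro a b
      obtain ⟨x, rfl⟩ := cls_surjective a
      obtain ⟨y, rfl⟩ := cls_surjective b
      simp only [← cls_inf, inf_comm])
    (by
      intro a b c
      obtain ⟨x, rfl⟩ := cls_surjective a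
      obtain ⟨y, rfl⟩ := cls_surjective b
      obtain ⟨z, rfl⟩ := cls_surjective c
      simp only [← cls_inf, inf_assoc])
    (by
      intro a b
      obtain ⟨x, rfl⟩ := cls_surjective a
      obtain ⟨y, rfl⟩ := cls_surjective b
      simp only [← cls_inf, ← cls_sup, sup_inf_self])
    (by
      intro a b
      obtain ⟨x, rfl⟩ := cls_surjective a
      obtain ⟨y, rfl⟩ := cls_surjective b
      simp only [← cls_inf, ← cls_sup, inf_sup_self])

theorem cls_le_cls {x y : A} : F.cls x ≤ F.cls y ↔ imp x y ∈ F.carrier := by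
  rw [← sup_eq_right]
  change F.cls (x ⊔ y) = F.cls y ↔ _
  rw [cls_eq]
  constructor
  · intro h
    refine F.mem_of_le ?_ h.1
    rw [le_imp_iff]
    exact (mul_mono le_rfl le_sup_left).trans imp_mul_le
  · intro h
    refine ⟨?_, F.mem_of_le (one_le_imp_iff.2 le_sup_right) F.one_mem⟩
    have := F.mem_of_le (imp_inf_one_le_imp_sup (z := y)) (F.inf_mem h F.one_mem)
    rwa [sup_idem] at this

instance : InvolutiveResiduatedLattice F.Quot where
  neg_neg := by
    intro a
    obtain ⟨x, rfl⟩ := cls_surjective a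
    simp only [← cls_neg, neg_neg]
  mul_le_iff := by
    intro a b c
    obtain ⟨x, rfl⟩ := cls_surjective a
    obtain ⟨y, rfl⟩ := cls_surjective b
    obtain ⟨z, rfl⟩ := cls_surjective c
    rw [← cls_mul, ← cls_neg, ← cls_neg, ← cls_mul, cls_le_cls, cls_le_cls]
    have : imp (x * y) z = imp (-z * y) (-x) := by
      simp only [imp, neg_neg]
      ac_rfl
    rw [this]

/-- The quotient homomorphism. -/
def proj (F : DeductiveFilter A) : Hom A F.Quot :=
  ⟨F.cls, cls_mul, cls_inf, cls_sup, cls_neg, rfl⟩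

theorem proj_surjective : Function.Surjective F.proj := cls_surjective

theorem proj_le {x y : A} : F.proj x ≤ F.proj y ↔ imp x y ∈ F.carrier := cls_le_cls

theorem one_le_proj {x : A} : 1 ≤ F.proj x ↔ x ∈ F.carrier := by
  rw [← F.proj.map_one, proj_le, imp_one_left]

end DeductiveFilter

/-! ### Negative elements in square-increasing algebras -/

section SquareIncreasing

variable {A : Type u} [InvolutiveResiduatedLattice A] (hs : ∀ x : A, x ≤ x * x)
  {x y z u v : A}

include hs

theorem inf_le_mul : x ⊓ y ≤ x * y :=
  (hs _).trans (mul_mono inf_le_left inf_le_right)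

theorem mul_self_of_le_one (hx : x ≤ 1) : x * x = x :=
  le_antisymm (mul_le_of_le_one_left hx) (hs x)

theorem mul_of_le_one (hx : x ≤ 1) (hy : y ≤ 1) : x * y = x ⊓ y :=
  le_antisymm (le_inf (mul_le_of_le_one_right hy) (mul_le_of_le_one_left hx)) (inf_le_mul hs)

theorem mul_eq_right_of_le_one (hx : x ≤ 1) (hu : 1 ≤ u) (h : u * x ≤ 1) : u * x = x := by
  refine le_antisymm ?_ (le_mul_of_one_le_left hu)
  calc u * x = u * x * x := by rw [mul_assoc, mul_self_of_le_one hs hx]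
    _ ≤ x := mul_le_of_le_one_left h

end SquareIncreasing

/-- The residual `x → 1`. -/
def star {A : Type u} [InvolutiveResiduatedLattice A] (x : A) : A := -(x * -1)

section Star

variable {A : Type u} [InvolutiveResiduatedLattice A] {x y z u v : A}

theorem le_star_iff : u ≤ star x ↔ u * x ≤ 1 := le_imp_iff (y := 1)

theorem star_mul_le : star x * x ≤ 1 := le_star_iff.1 le_rfl

theorem le_star_comm : u ≤ star x ↔ x ≤ star u := by
  rw [le_star_iff, le_star_iff, mul_comm]

theorem le_star_star : x ≤ star (star x) := le_star_comm.1 le_rfl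

theorem star_anti (h : x ≤ y) : star y ≤ star x := le_star_comm.1 (h.trans le_star_star)

theorem star_star_star : star (star (star x)) = star x :=
  le_antisymm (star_anti le_star_star) le_star_star

theorem one_le_star (h : x ≤ 1) : 1 ≤ star x := by
  rwa [le_star_iff, one_mul]

theorem star_le_one (h : 1 ≤ x) : star x ≤ 1 := by
  refine le_trans ?_ (star_mul_le (x := x))
  exact le_mul_of_one_le_right h

theorem star_one : star (1 : A) = 1 := by simp [star]

theorem neg_star : -star x = x * -1 := neg_neg _

theorem Hom.map_star {B : Type v} [InvolutiveResiduatedLattice B] (f : Hom A B) (x : A) :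
    f (star x) = star (f x) := by
  simp [star, f.map_neg, f.map_mul, f.map_one]

theorem star_mul_neg_one : star x * -1 = -star (star x) := (neg_star (x := star x)).symm

variable (hs : ∀ x : A, x ≤ x * x)

include hs

theorem star_mul_self (hx : x ≤ 1) : star x * x = x :=
  mul_eq_right_of_le_one hs hx (one_le_star hx) star_mul_le

theorem star_mul_star_self (hx : x ≤ 1) : star x * star x = star x := by
  refine le_antisymm ?_ (hs _)
  rw [le_star_iff, mul_assoc, star_mul_self hs hx, star_mul_self hs hx]
  exact hx

end Star

/-! ### Products in De Morgan chains -/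

section Chain

variable {A : Type u} [InvolutiveResiduatedLattice A] (hc : ∀ x y : A, x ≤ y ∨ y ≤ x)
  (hs : ∀ x : A, x ≤ x * x) {x y z u v w : A}

include hc

theorem le_of_not_ge' (h : ¬ x ≤ y) : y ≤ x := (hc x y).resolve_left h

theorem inf_eq_or (x y : A) : x ⊓ y = x ∨ x ⊓ y = y :=
  (hc x y).imp inf_eq_left.2 inf_eq_right.2

theorem sup_eq_or (x y : A) : x ⊔ y = x ∨ x ⊔ y = y :=
  (hc x y).symm.imp sup_eq_left.2 sup_eq_right.2

include hs

/-- The product is the negation of `imp x y`, which is `star x` when `x ≤ y` and `y` otherwise. -/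
theorem mul_neg_eq (hx : x ≤ 1) (hy : y ≤ 1) : x * -y = x * -1 ∨ x * -y = -y := by
  by_cases h : x ≤ y
  · left
    rw [← neg_inj]
    change imp x y = star x
    apply le_antisymm
    · rw [le_star_iff]
      exact imp_mul_le.trans hy
    · rw [le_imp_iff, star_mul_self hs hx]
      exact h
  · right
    rw [← neg_inj, neg_neg]
    change imp x y = y
    apply le_antisymm
    · have h1 : imp x y ≤ 1 := by
        by_contra h1
        have h1 := le_of_not_ge' hc h1
        exact h (one_le_imp_iff.1 h1)
      have h2 : imp x y * x ≤ y := imp_mul_le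
      rw [mul_of_le_one hs h1 hx] at h2
      rcases inf_eq_or hc (imp x y) x with h3 | h3
      · rwa [h3] at h2
      · rw [h3] at h2
        exact absurd h2 h
    · rw [le_imp_iff]
      exact mul_le_of_le_one_right hx

/-- A product below `1` is absorbed by the idempotent `x`; one above `1` is absorbed by the
idempotent `star y`. -/
theorem mul_star_eq (hx : x ≤ 1) (hy : y ≤ 1) : x * star y = x ∨ x * star y = star y := by
  by_cases h : x * star y ≤ 1
  · left
    rw [mul_comm] at h ⊢
    exact mul_eq_right_of_le_one hs hx (one_le_star hy) h
  · right
    refine le_antisymm (mul_le_of_le_one_left hx) ?_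
    calc star y ≤ star y * (x * star y) := le_mul_of_one_le_right (le_of_not_ge' hc h)
      _ = x * (star y * star y) := by rw [mul_left_comm]
      _ = x * star y := by rw [star_mul_star_self hs hy]

theorem star_mul_star (hx : x ≤ 1) (hy : y ≤ 1) :
    star x * star y = star x ∨ star x * star y = star y := by
  have key : ∀ a b : A, a ≤ 1 → b ≤ 1 → star a ≤ star b → star a * star b = star b := by
    intro a b ha hb h
    refine le_antisymm ?_ (le_mul_of_one_le_left (one_le_star ha))
    exact (mul_mono_left h _).trans (star_mul_star_self hs hb).le
  rcases hc (star x) (star y) with h | h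
  · exact Or.inr (key x y hx hy h)
  · rw [mul_comm]
    exact Or.inl (key y x hy hx h)

omit hc in
theorem star_mul_neg (hx : x ≤ 1) (hz : z ≤ 1) :
    star x * -z = -(z ⊓ star (star x)) := by
  rw [← neg_inj, neg_neg]
  change imp (star x) z = _
  apply le_antisymm
  · have h : imp (star x) z * star x ≤ z := imp_mul_le
    refine le_inf ?_ (le_star_iff.2 (h.trans hz))
    exact (le_mul_of_one_le_right (one_le_star hx)).trans h
  · rw [le_imp_iff]
    have h1 : (z ⊓ star (star x)) ≤ 1 := inf_le_left.trans hz
    have h2 : star x * (z ⊓ star (star x)) ≤ 1 := by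
      rw [mul_comm]
      exact (mul_mono_left inf_le_right _).trans star_mul_le
    rw [mul_comm, mul_eq_right_of_le_one hs h1 (one_le_star hx) h2]
    exact inf_le_left

omit hc in
theorem mul_neg_one_of_le (h : (-1 : A) ≤ 1) (hx : x ≤ 1) : x * -1 = x ⊓ -1 :=
  mul_of_le_one hs hx h

/-- Here `x` and `-x` are both negative, so their product, always at most `-1`, is their meet, hence
one of them. -/
theorem eq_or_eq_of_neg_one_le (h : -1 ≤ x) (hx : x ≤ 1) : x = -1 ∨ x = 1 := by
  have hx' : -x ≤ 1 := by rwa [neg_le_comm]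
  have h1 : x * -x ≤ -1 := by rw [mul_le_neg_one_iff, neg_neg]
  rw [mul_of_le_one hs hx hx'] at h1
  rcases inf_eq_or hc x (-x) with h2 | h2
  · rw [h2] at h1
    exact Or.inl (le_antisymm h1 h)
  · rw [h2, neg_le_neg_iff'] at h1
    exact Or.inr (le_antisymm hx h1)

/-! ### The case `-1 ≰ 1` -/

section NotIdempotent

variable (hf : ¬ (-1 : A) ≤ 1)

include hf

theorem neg_one_cube : (-1 * -1 * -1 : A) = -1 * -1 := by
  have he := le_of_not_ge' hc hf
  refine le_antisymm ?_ (le_mul_of_one_le_right he)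
  -- This `b` is a negative idempotent, so the factor `b` may be doubled and split between `-1 * b ≤
  -- 1` and `(-1 * -1) * b ≤ -1`.
  set b : A := -(-1 * -1) with hb
  have hb' : -1 * -1 = -b := by rw [hb, neg_neg]
  have hb1 : b ≤ 1 := by
    rw [hb, neg_le_comm]
    exact le_mul_of_one_le_left he
  have hbb := mul_self_of_le_one hs hb1
  have h2 : (-1 * -1) * b ≤ -1 := by rw [mul_le_neg_one_iff, hb']
  have h1 : -1 * b ≤ 1 := by
    have : (-1 * b) * -1 ≤ -1 := by rwa [mul_right_comm]
    rwa [mul_le_neg_one_iff, neg_neg] at this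
  rw [hb', ← mul_le_neg_one_iff, ← hb']
  calc -1 * -1 * -1 * b = -1 * -1 * -1 * (b * b) := by rw [hbb]
    _ = (-1 * b) * ((-1 * -1) * b) := by ac_rfl
    _ ≤ 1 * -1 := mul_mono h1 h2
    _ = -1 := one_mul _

omit hs in
theorem le_one_of_mul_neg_one_eq (hw : w ≤ -1) (h : w * -1 = w) : w ≤ 1 := by
  by_contra h1
  have h1 := le_of_not_ge' hc h1
  have h2 : -1 ≤ w := (le_mul_of_one_le_left h1).trans h.le
  obtain rfl : w = -1 := le_antisymm hw h2
  apply hf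
  have := mul_le_neg_one_iff.1 h.le
  rwa [neg_neg] at this

/-- The product is at most `-1` and, by `neg_one_cube`, fixed by multiplication by `-1`; this forces
it below `1`, where the idempotent `v` absorbs it. -/
theorem neg_one_sq_mul (hv : v ≤ -(-1 * -1)) : v * (-1 * -1) = v := by
  have he := le_of_not_ge' hc hf
  have h1 : 1 ≤ (-1 * -1 : A) := he.trans (le_mul_of_one_le_left he)
  have hv1 : v ≤ 1 := by
    refine hv.trans ?_
    rw [neg_le_comm]
    exact le_mul_of_one_le_left he
  rw [mul_comm]
  apply mul_eq_right_of_le_one hs hv1 h1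
  apply le_one_of_mul_neg_one_eq hc hf
  · rwa [mul_comm, mul_le_neg_one_iff]
  · rw [mul_right_comm, neg_one_cube hc hs hf]

theorem mul_neg_one_of_le_bot (hv : v ≤ -(-1 * -1)) : v * -1 = v := by
  have he := le_of_not_ge' hc hf
  refine le_antisymm ?_ (le_mul_of_one_le_right he)
  calc v * -1 ≤ v * (-1 * -1) := mul_mono le_rfl (le_mul_of_one_le_right he)
    _ = v := neg_one_sq_mul hc hs hf hv

theorem neg_mul_neg_self (hv : v ≤ -(-1 * -1)) : -v * -v = -v := by
  have he := le_of_not_ge' hc hf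
  have hv1 : v ≤ 1 := by
    refine hv.trans ?_
    rw [neg_le_comm]
    exact le_mul_of_one_le_left he
  have hu : 1 ≤ -v := he.trans (by rwa [neg_le_neg_iff'])
  refine le_antisymm ?_ (hs _)
  rw [mul_le_iff, neg_neg, mul_comm]
  refine (mul_eq_right_of_le_one hs hv1 hu ?_).le
  apply le_one_of_mul_neg_one_eq hc hf
  · rw [mul_le_neg_one_iff]
  · rw [mul_assoc, mul_neg_one_of_le_bot hc hs hf hv]

/-- Elements from `-1` up to `-1 * -1` multiply to `-1 * -1` by `neg_one_cube`; above that,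
negations of negative elements are idempotent and the larger factor wins. -/
theorem neg_mul_neg_of_le (hy : y ≤ 1) (hzy : z ≤ y) :
    -y * -z = -z ∨ -y * -z = -1 * -1 := by
  have he := le_of_not_ge' hc hf
  have hy' : -1 ≤ -y := neg_le_neg_iff'.2 hy
  have hzy' : -y ≤ -z := neg_le_neg_iff'.2 hzy
  by_cases h : z ≤ -(-1 * -1)
  · left
    refine le_antisymm ?_ (le_mul_of_one_le_left (he.trans hy'))
    exact (mul_mono_left hzy' _).trans (neg_mul_neg_self hc hs hf h).le
  · right
    have h : -z ≤ -1 * -1 := neg_le_comm.1 (le_of_not_ge' hc h)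
    refine le_antisymm ?_ (mul_mono hy' (hy'.trans hzy'))
    calc -y * -z ≤ (-1 * -1) * (-1 * -1) := mul_mono (hzy'.trans h) h
      _ = -1 * -1 := by rw [← mul_assoc, neg_one_cube hc hs hf, neg_one_cube hc hs hf]

end NotIdempotent

end Chain

/-! ### Subalgebras spanned by negative cones -/

/-- The elements obtained from those of `J` by the unary polynomials `x`, `-x`, `x * -1`
and `-(x * -1)`. -/
def span {A : Type u} [InvolutiveResiduatedLattice A] (J : Set A) : Set A :=
  {u | ∃ x ∈ J, u = x ∨ u = -x ∨ u = -star x ∨ u = star x}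

/-- A set of negative elements of a De Morgan chain that is the negative cone of a subalgebra. -/
structure IsNegativeCone {A : Type u} [InvolutiveResiduatedLattice A] (J : Set A) : Prop where
  le_one : ∀ x ∈ J, x ≤ 1
  one_mem : 1 ∈ J
  neg_one_mem : (-1 : A) ≤ 1 → -1 ∈ J
  bot_mem : -(-1 * -1) ∈ J
  star_star_mem : ∀ x ∈ J, star (star x) ∈ J

namespace IsNegativeCone

variable {A : Type u} [InvolutiveResiduatedLattice A] {J : Set A} (hJ : IsNegativeCone J)
  (hc : ∀ x y : A, x ≤ y ∨ y ≤ x) (hs : ∀ x : A, x ≤ x * x) {x y z u v w : A}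

omit hJ in
theorem _root_.InvolutiveResiduatedLattice.mem_span (hx : x ∈ J) : x ∈ span J :=
  ⟨x, hx, Or.inl rfl⟩

omit hJ in
theorem _root_.InvolutiveResiduatedLattice.neg_mem_span (hx : x ∈ J) : -x ∈ span J :=
  ⟨x, hx, Or.inr (Or.inl rfl)⟩

omit hJ in
theorem _root_.InvolutiveResiduatedLattice.neg_star_mem_span (hx : x ∈ J) : -star x ∈ span J :=
  ⟨x, hx, Or.inr (Or.inr (Or.inl rfl))⟩

omit hJ in
theorem _root_.InvolutiveResiduatedLattice.star_mem_span (hx : x ∈ J) : star x ∈ span J :=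
  ⟨x, hx, Or.inr (Or.inr (Or.inr rfl))⟩

include hc in
omit hJ in
theorem inf_mem' (hx : x ∈ J) (hy : y ∈ J) : x ⊓ y ∈ J := by
  rcases inf_eq_or hc x y with h | h <;> rwa [h]

include hJ

theorem neg_one_sq_mem : (-1 * -1 : A) ∈ span J := by
  have := neg_mem_span hJ.bot_mem
  rwa [neg_neg] at this

include hs hc

theorem neg_mul_neg_mem (hy : y ∈ J) (hz : z ∈ J) : -y * -z ∈ span J := by
  by_cases hf : (-1 : A) ≤ 1
  -- When `-1 ≤ 1`, this reduces everything to products of elements of `J` and their stars.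
  · have key : ∀ x ∈ J, -x ∈ J ∨ -x = star x := by
      intro x hx
      by_cases h : x ≤ -1
      · right
        rw [star, mul_neg_one_of_le hs hf (hJ.le_one x hx), inf_eq_left.2 h]
      · left
        rcases eq_or_eq_of_neg_one_le hc hs (le_of_not_ge' hc h) (hJ.le_one x hx) with rfl | rfl
        · rw [neg_neg]
          exact hJ.one_mem
        · exact hJ.neg_one_mem hf
    rcases key y hy with h | h <;> rcases key z hz with h' | h'
    · rw [mul_of_le_one hs (hJ.le_one _ h) (hJ.le_one _ h')]
      exact mem_span (inf_mem' hc h h')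
    · rw [h']
      rcases mul_star_eq hc hs (hJ.le_one _ h) (hJ.le_one _ hz) with e | e <;> rw [e]
      exacts [mem_span h, star_mem_span hz]
    · rw [h, mul_comm]
      rcases mul_star_eq hc hs (hJ.le_one _ h') (hJ.le_one _ hy) with e | e <;> rw [e]
      exacts [mem_span h', star_mem_span hy]
    · rw [h, h']
      rcases star_mul_star hc hs (hJ.le_one _ hy) (hJ.le_one _ hz) with e | e <;> rw [e]
      exacts [star_mem_span hy, star_mem_span hz]
  · have key : ∀ y ∈ J, ∀ z ∈ J, z ≤ y → -y * -z ∈ span J := by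
      intro y hy z hz h
      rcases neg_mul_neg_of_le hc hs hf (hJ.le_one y hy) h with e | e <;> rw [e]
      exacts [neg_mem_span hz, hJ.neg_one_sq_mem]
    rcases hc y z with h | h
    · rw [mul_comm]
      exact key z hz y hy h
    · exact key y hy z hz h

theorem mul_neg_mem (hx : x ∈ J) (hy : y ∈ J) : x * -y ∈ span J := by
  rcases mul_neg_eq hc hs (hJ.le_one x hx) (hJ.le_one y hy) with e | e <;> rw [e]
  · rw [← neg_star]
    exact neg_star_mem_span hx
  · exact neg_mem_span hy

theorem mul_neg_one_sq_mem (hx : x ∈ J) : x * (-1 * -1) ∈ span J := by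
  simpa using hJ.mul_neg_mem hc hs hx hJ.bot_mem

theorem mul_mem_span_left (hx : x ∈ J) (hu : u ∈ span J) : x * u ∈ span J := by
  obtain ⟨y, hy, rfl | rfl | rfl | rfl⟩ := hu
  · rw [mul_of_le_one hs (hJ.le_one x hx) (hJ.le_one u hy)]
    exact mem_span (inf_mem' hc hx hy)
  · exact hJ.mul_neg_mem hc hs hx hy
  · rw [neg_star, ← mul_assoc, mul_of_le_one hs (hJ.le_one x hx) (hJ.le_one y hy), ← neg_star]
    exact neg_star_mem_span (inf_mem' hc hx hy)
  · rcases mul_star_eq hc hs (hJ.le_one x hx) (hJ.le_one y hy) with e | e <;> rw [e]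
    exacts [mem_span hx, star_mem_span hy]

theorem mul_neg_one_mem (hu : u ∈ span J) : u * -1 ∈ span J := by
  obtain ⟨y, hy, rfl | rfl | rfl | rfl⟩ := hu
  · rw [← neg_star]
    exact neg_star_mem_span hy
  · exact hJ.neg_mul_neg_mem hc hs hy hJ.one_mem
  · rw [neg_star, mul_assoc]
    exact hJ.mul_neg_one_sq_mem hc hs hy
  · rw [star_mul_neg_one]
    exact neg_mem_span (hJ.star_star_mem y hy)

theorem neg_mul_mem_span (hx : x ∈ J) (hu : u ∈ span J) : -x * u ∈ span J := by
  obtain ⟨y, hy, rfl | rfl | rfl | rfl⟩ := hu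
  · rw [mul_comm]
    exact hJ.mul_neg_mem hc hs hy hx
  · exact hJ.neg_mul_neg_mem hc hs hx hy
  · rw [neg_star, ← mul_assoc, mul_comm (-x)]
    exact hJ.mul_neg_one_mem hc hs (hJ.mul_neg_mem hc hs hy hx)
  · rw [mul_comm, star_mul_neg hs (hJ.le_one y hy) (hJ.le_one x hx)]
    exact neg_mem_span (inf_mem' hc hx (hJ.star_star_mem y hy))

theorem star_mul_mem_span (hx : x ∈ J) (hu : u ∈ span J) : star x * u ∈ span J := by
  obtain ⟨y, hy, rfl | rfl | rfl | rfl⟩ := hu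
  · rw [mul_comm]
    exact hJ.mul_mem_span_left hc hs hy (star_mem_span hx)
  · rw [mul_comm]
    exact hJ.neg_mul_mem_span hc hs hy (star_mem_span hx)
  · rw [neg_star, ← mul_assoc, mul_comm (star x)]
    exact hJ.mul_neg_one_mem hc hs (hJ.mul_mem_span_left hc hs hy (star_mem_span hx))
  · rcases star_mul_star hc hs (hJ.le_one x hx) (hJ.le_one y hy) with e | e <;> rw [e]
    exacts [star_mem_span hx, star_mem_span hy]

theorem isSubuniverse_span : IsSubuniverse (span J) where
  mul_mem := by
    rintro u ⟨x, hx, rfl | rfl | rfl | rfl⟩ v hv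
    · exact hJ.mul_mem_span_left hc hs hx hv
    · exact hJ.neg_mul_mem_span hc hs hx hv
    · rw [neg_star, mul_assoc, mul_comm (-1)]
      exact hJ.mul_mem_span_left hc hs hx (hJ.mul_neg_one_mem hc hs hv)
    · exact hJ.star_mul_mem_span hc hs hx hv
  inf_mem x hx y hy := by rcases inf_eq_or hc x y with h | h <;> rwa [h]
  sup_mem x hx y hy := by rcases sup_eq_or hc x y with h | h <;> rwa [h]
  neg_mem := by
    rintro u ⟨x, hx, rfl | rfl | rfl | rfl⟩
    · exact neg_mem_span hx
    · rw [neg_neg]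
      exact mem_span hx
    · rw [neg_neg]
      exact star_mem_span hx
    · exact neg_star_mem_span hx
  one_mem := mem_span hJ.one_mem

/-- Each of the other three forms is negative only in degenerate cases. If `-1 ≰ 1`, a negative `x *
-1` forces `x` so low that multiplying by `-1` fixes it. -/
theorem mem_of_mem_span (hu : u ∈ span J) (h : u ≤ 1) : u ∈ J := by
  obtain ⟨x, hx, rfl | rfl | rfl | rfl⟩ := hu
  · exact hx
  · have h1 : -1 ≤ x := neg_le_comm.1 h
    rcases eq_or_eq_of_neg_one_le hc hs h1 (hJ.le_one x hx) with rfl | rfl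
    · rw [neg_neg]
      exact hJ.one_mem
    · exact hJ.neg_one_mem h
  · rw [neg_star] at h ⊢
    by_cases hf : (-1 : A) ≤ 1
    · rw [mul_neg_one_of_le hs hf (hJ.le_one x hx)]
      exact inf_mem' hc hx (hJ.neg_one_mem hf)
    · rw [mul_neg_one_of_le_bot hc hs hf]
      · exact hx
      · rw [← mul_le_neg_one_iff, ← mul_assoc]
        exact mul_le_of_le_one_left h
  · rw [le_antisymm h (one_le_star (hJ.le_one x hx))]
    exact hJ.one_mem

end IsNegativeCone

/-! ### Retractions of De Morgan chains -/

theorem isNegativeCone_setOf_le_one {B : Type u} [InvolutiveResiduatedLattice B]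
    (hs : ∀ x : B, x ≤ x * x) : IsNegativeCone {x : B | x ≤ 1} where
  le_one _ hx := hx
  one_mem := le_rfl
  neg_one_mem h := h
  bot_mem := by
    change -(-1 * -1) ≤ (1 : B)
    rw [neg_le_comm]
    exact hs _
  star_star_mem x hx := star_le_one (one_le_star hx)

/-- The deductive filter whose carrier is an upward closed, `⊓`-closed set containing `1`. -/
def DeductiveFilter.ofInf {B : Type u} [InvolutiveResiduatedLattice B]
    (hs : ∀ x : B, x ≤ x * x) (S : Set B) (h1 : 1 ∈ S)
    (hinf : ∀ {x y}, x ∈ S → y ∈ S → x ⊓ y ∈ S) (hle : ∀ {x y}, x ≤ y → x ∈ S → y ∈ S) :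
    DeductiveFilter B :=
  ⟨S, h1, hinf, fun hx hy => hle (inf_le_mul hs) (hinf hx hy), hle⟩

/-- In a negatively generated De Morgan chain, a subalgebra whose negative elements other than `1`
are all below some fixed `b < 1` is fixed by an endomorphism that sends `b` to `1`. -/
theorem exists_endomorphism_of_lt {A B : Type u} [InvolutiveResiduatedLattice A]
    [InvolutiveResiduatedLattice B] (hc : ∀ x y : B, x ≤ y ∨ y ≤ x) (hs : ∀ x : B, x ≤ x * x)
    (hA : NegativelyGenerated A) (hB : NegativelyGenerated B) (f : Hom A B) {b : B}
    (hb1 : b ≤ 1) (hb : ∀ a, f a < 1 → f a < b) :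
    ∃ g : Hom B B, (∀ a, g (f a) = f a) ∧ g b = 1 := by
  let J : Set B := {x | x ≤ 1 ∧ (x = 1 ∨ ∃ a, x ≤ f a ∧ f a < 1)}
  have hmem : ∀ a, f a ≤ 1 → f a ∈ J := by
    intro a ha
    refine ⟨ha, ?_⟩
    rcases ha.eq_or_lt with h | h
    exacts [Or.inl h, Or.inr ⟨a, le_rfl, h⟩]
  have hcone := isNegativeCone_setOf_le_one hs
  have hJ : IsNegativeCone J :=
    { le_one := fun x hx => hx.1
      one_mem := ⟨le_rfl, Or.inl rfl⟩
      neg_one_mem := fun h => by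
        rw [← f.map_one, ← f.map_neg] at h ⊢
        exact hmem _ (by rwa [f.map_one] at h)
      bot_mem := by
        have h := hcone.bot_mem
        have e : f (-(-1 * -1)) = -(-1 * -1) := by simp [f.map_neg, f.map_mul, f.map_one]
        rw [← e] at h ⊢
        exact hmem _ h
      star_star_mem := by
        rintro x ⟨hx, rfl | ⟨a, hxa, ha⟩⟩
        · rw [star_one, star_one]
          exact ⟨le_rfl, Or.inl rfl⟩
        · have hx' : star (star x) ≤ 1 := hcone.star_star_mem x hx
          rcases hc (star (star x)) (f a) with h | h
          · exact ⟨hx', Or.inr ⟨a, h, ha⟩⟩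
          -- With `x ≤ f a ≤ star (star x)` the stars of `x` and `f a` coincide, so `star (star x)`
          -- lies in the range of `f`.
          · have e : star (f a) = star x := by
              refine le_antisymm (star_anti hxa) ?_
              rw [← star_star_star]
              exact star_anti h
            rw [← e, ← f.map_star, ← f.map_star] at hx' ⊢
            exact hmem _ hx' }
  let F : DeductiveFilter B := DeductiveFilter.ofInf hs {x | ∀ a, f a < 1 → f a < x}
    (fun a h => h) (fun hx hy a h => by
      rcases inf_eq_or hc _ _ with e | e
      · exact e.symm ▸ hx a h
      · exact e.symm ▸ hy a h) (fun h hx a ha => (hx a ha).trans_le h)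
  have hJF : ∀ x ∈ J, x ∈ F.carrier → x = 1 := by
    rintro x ⟨-, rfl | ⟨a, hxa, ha⟩⟩ hx
    · rfl
    · exact absurd (hx a ha) hxa.not_gt
  have hJF' : ∀ x ≤ 1, x ∈ J ∨ x ∈ F.carrier := by
    intro x hx
    by_cases h : x ∈ F.carrier
    · exact Or.inr h
    · have h : ¬ ∀ a, f a < 1 → f a < x := h
      push Not at h
      obtain ⟨a, ha, h⟩ := h
      refine Or.inl ⟨hx, Or.inr ⟨a, ?_, ha⟩⟩
      rcases hc x (f a) with h' | h'
      exacts [h', (h'.eq_or_lt.resolve_right h).ge]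
  have hS := hJ.isSubuniverse_span hc hs
  -- The negative part of `imp s t` lies in both `J` and `F`, hence is `1`: the projection is
  -- faithful on `span J`.
  have hle : ∀ s ∈ span J, ∀ t ∈ span J, F.proj s ≤ F.proj t → s ≤ t := by
    intro s hs' t ht h
    rw [DeductiveFilter.proj_le] at h
    have h1 : imp s t ⊓ 1 ∈ J := hJ.mem_of_mem_span hc hs
      (hS.inf_mem _ (hS.imp_mem hs' ht) _ hS.one_mem) inf_le_right
    rw [← one_le_imp_iff]
    exact inf_eq_right.1 (hJF _ h1 (F.inf_mem h F.one_mem))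
  have hinj : ∀ s ∈ span J, ∀ t ∈ span J, F.proj s = F.proj t → s = t := fun s hs' t ht h =>
    le_antisymm (hle s hs' t ht h.le) (hle t ht s hs' h.ge)
  -- Negative generation makes `B` the span of its negative cone, and a negative element outside `J`
  -- is congruent to `1`.
  have hex : ∀ u, ∃ s ∈ span J, F.proj s = F.proj u := by
    intro u
    have hu : u ∈ span {x : B | x ≤ 1} := by
      rw [hB.eq_univ (hcone.isSubuniverse_span hc hs) fun a ha => mem_span ha]
      trivial
    obtain ⟨x, hx, hu⟩ := hu
    obtain ⟨y, hy, hyx⟩ : ∃ y ∈ J, F.proj y = F.proj x := by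
      rcases hJF' x hx with h | h
      · exact ⟨x, h, rfl⟩
      · refine ⟨1, hJ.one_mem, ?_⟩
        rw [F.proj.map_one]
        refine le_antisymm (DeductiveFilter.one_le_proj.2 h) ?_
        rw [← F.proj.map_one]
        exact F.proj.mono hx
    rcases hu with rfl | rfl | rfl | rfl
    · exact ⟨y, mem_span hy, hyx⟩
    · exact ⟨-y, neg_mem_span hy, by rw [F.proj.map_neg, hyx, F.proj.map_neg]⟩
    · exact ⟨-star y, neg_star_mem_span hy, by
        rw [F.proj.map_neg, F.proj.map_star, hyx, F.proj.map_neg, F.proj.map_star]⟩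
    · exact ⟨star y, star_mem_span hy, by rw [F.proj.map_star, hyx, F.proj.map_star]⟩
  -- `g` sends each element to the unique member of `span J` in its congruence class, so identities
  -- can be checked modulo `F`.
  choose g hgS hg using hex
  have hgs : ∀ s ∈ span J, g s = s := fun s hs' => hinj _ (hgS s) _ hs' (hg s)
  have hfS : ∀ a, f a ∈ span J := by
    have := hA.eq_univ (f.isSubuniverse_preimage hS) fun a ha => mem_span (hmem a (by
      rw [← f.map_one]
      exact f.mono ha))
    exact fun a => (Set.eq_univ_iff_forall.1 this) a
  refine ⟨⟨g, fun x y => ?_, fun x y => ?_, fun x y => ?_, fun x => ?_, ?_⟩, fun a => ?_, ?_⟩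
  · exact hinj _ (hgS _) _ (hS.mul_mem _ (hgS _) _ (hgS _)) (by
      rw [hg, F.proj.map_mul, F.proj.map_mul, hg, hg])
  · exact hinj _ (hgS _) _ (hS.inf_mem _ (hgS _) _ (hgS _)) (by
      rw [hg, F.proj.map_inf, F.proj.map_inf, hg, hg])
  · exact hinj _ (hgS _) _ (hS.sup_mem _ (hgS _) _ (hgS _)) (by
      rw [hg, F.proj.map_sup, F.proj.map_sup, hg, hg])
  · exact hinj _ (hgS _) _ (hS.neg_mem _ (hgS _)) (by
      rw [hg, F.proj.map_neg, F.proj.map_neg, hg])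
  · exact hgs 1 hS.one_mem
  · exact hgs _ (hfS a)
  · refine hinj _ (hgS _) _ hS.one_mem ?_
    rw [hg]
    refine le_antisymm (F.proj.mono hb1) ?_
    rw [F.proj.map_one]
    exact DeductiveFilter.one_le_proj.2 hb

/-! ### Epimorphisms into chains -/

section Class

variable {K : (A : Type u) → [InvolutiveResiduatedLattice A] → Prop} {A B C : Type u}
  [InvolutiveResiduatedLattice A] [InvolutiveResiduatedLattice B] [InvolutiveResiduatedLattice C]

theorem IsEpimorphism.comp_of_surjective {f : Hom A B} (hf : IsEpimorphism K f) {q : Hom B C}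
    (hq : Function.Surjective q) : IsEpimorphism K (q.comp f) := by
  intro D _ hD g h hgh
  have h1 : g.comp q = h.comp q := hf D hD _ _ (by
    funext a
    exact congrFun hgh a)
  ext c
  obtain ⟨b, rfl⟩ := hq c
  exact congrFun (congrArg Hom.toFun h1) b

variable (hK : IsVariety K)
  (hdm : ∀ (A : Type u) [InvolutiveResiduatedLattice A],
    K A → IsDeMorganMonoid A ∧ Semilinear A ∧ NegativelyGenerated A)

include hK hdm

theorem IsEpimorphism.surjective_of_chain (hc : ∀ x y : B, x ≤ y ∨ y ≤ x) (hA : K A) (hB : K B)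
    {f : Hom A B} (hf : IsEpimorphism K f) : Function.Surjective f := by
  refine Hom.surjective_of_negative (hdm B hB).2.2 fun b hb1 => ?_
  by_contra hb
  have hs := (hdm B hB).1.le_mul_self
  have hb1' : b < 1 := hb1.lt_of_ne fun e => hb ⟨1, by rw [f.map_one, e]⟩
  -- Collapse exactly what is forced by the image elements above `b`; `b` itself stays outside this
  -- filter.
  let G : DeductiveFilter B := DeductiveFilter.ofInf hs {x | ∃ a, b < f a ∧ f a ≤ x}
    ⟨1, by rwa [f.map_one], by rw [f.map_one]⟩ (by
      rintro x y ⟨a, ha, hax⟩ ⟨a', ha', hay⟩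
      refine ⟨a ⊓ a', ?_, ?_⟩
      · rw [f.map_inf]
        rcases inf_eq_or hc (f a) (f a') with e | e <;> rwa [e]
      · rw [f.map_inf]
        exact inf_le_inf hax hay) (by
      rintro x y h ⟨a, ha, hax⟩
      exact ⟨a, ha, hax.trans h⟩)
  have hKQ : K G.Quot := hK.image B _ G.proj G.proj_surjective hB
  have hcQ : ∀ x y : G.Quot, x ≤ y ∨ y ≤ x := by
    intro x y
    obtain ⟨x, rfl⟩ := G.proj_surjective x
    obtain ⟨y, rfl⟩ := G.proj_surjective y
    exact (hc x y).imp G.proj.mono G.proj.mono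
  have hfQ := hf.comp_of_surjective (C := G.Quot) G.proj_surjective
  obtain ⟨g, hgf, hgb⟩ := exists_endomorphism_of_lt hcQ (hdm _ hKQ).1.le_mul_self (hdm A hA).2.2
    (hdm _ hKQ).2.2 (G.proj.comp f) (b := G.proj b)
    (by rw [← G.proj.map_one]; exact G.proj.mono hb1) (by
      intro a ha
      change G.proj (f a) < 1 at ha
      change G.proj (f a) < G.proj b
      have h1 : ¬ b < f a := fun h => ha.not_ge (DeductiveFilter.one_le_proj.2 ⟨a, h, le_rfl⟩)
      have h2 : f a ≤ b := by
        rcases hc (f a) b with h | h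
        · exact h
        · exact (h.eq_or_lt.resolve_right h1).ge
      refine lt_of_le_not_ge (G.proj.mono h2) fun h => ?_
      rw [DeductiveFilter.proj_le] at h
      obtain ⟨a', ha', h⟩ := h
      rw [le_imp_iff] at h
      -- Since `b ≤ b * b ≤ f a' * b ≤ f a`, a collapse of `f a` with `b` would put `b` in the
      -- range.
      have h3 : b ≤ f a := by
        refine le_trans ?_ h
        refine (hs b).trans (mul_mono_left ha'.le b)
      exact hb ⟨a, le_antisymm h2 h3⟩)
  have h := hfQ _ hKQ g (Hom.id _) (funext hgf)
  rw [h] at hgb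
  have h1 : 1 ≤ G.proj b := hgb.ge
  rw [DeductiveFilter.one_le_proj] at h1
  obtain ⟨a, ha, hab⟩ := h1
  exact hab.not_gt ha

end Class

/-! ### Linear filters -/

/-- Coordinatewise one of the two residuals is above `1`. This makes the complement of a prime ideal
that omits `1` a linear filter. -/
theorem Semilinear.one_le_imp_sup_imp {B : Type u} [InvolutiveResiduatedLattice B]
    (hB : Semilinear B) (x y : B) : 1 ≤ imp x y ⊔ imp y x := by
  obtain ⟨ι, T, _, hT, f, hf, -⟩ := hB
  have h : f 1 ≤ f (imp x y ⊔ imp y x) := by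
    rw [f.map_one, f.map_sup, f.map_imp, f.map_imp]
    intro i
    rcases hT i (f x i) (f y i) with h | h
    · exact le_sup_of_le_left (one_le_imp_iff.2 h)
    · exact le_sup_of_le_right (one_le_imp_iff.2 h)
  rw [← inf_eq_left] at h ⊢
  apply hf
  rw [f.map_inf, h]

/-- A deductive filter is linear if its quotient algebra is totally ordered. -/
def DeductiveFilter.IsLinear {B : Type u} [InvolutiveResiduatedLattice B]
    (F : DeductiveFilter B) : Prop :=
  ∀ x y, imp x y ∈ F.carrier ∨ imp y x ∈ F.carrier

theorem DeductiveFilter.IsLinear.total {B : Type u} [InvolutiveResiduatedLattice B]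
    {F : DeductiveFilter B} (hF : F.IsLinear) (x y : F.Quot) : x ≤ y ∨ y ≤ x := by
  obtain ⟨x, rfl⟩ := F.proj_surjective x
  obtain ⟨y, rfl⟩ := F.proj_surjective y
  rw [proj_le, proj_le]
  exact hF x y

open Order in
/-- The prime filter theorem for semilinear De Morgan monoids. -/
theorem exists_isLinear_disjoint {B : Type u} [InvolutiveResiduatedLattice B]
    (hdm : IsDeMorganMonoid B) (hB : Semilinear B) (F₀ : DeductiveFilter B) {I : Set B}
    (hI : IsLowerSet I) (hsup : ∀ x ∈ I, ∀ y ∈ I, x ⊔ y ∈ I) (hd : Disjoint F₀.carrier I) :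
    ∃ F : DeductiveFilter B, F.IsLinear ∧ F₀.carrier ⊆ F.carrier ∧ Disjoint F.carrier I := by
  -- Order ideals must be nonempty; for empty `I` the improper filter, with trivial quotient,
  -- serves.
  rcases I.eq_empty_or_nonempty with rfl | hne
  · exact ⟨⟨Set.univ, trivial, fun _ _ => trivial, fun _ _ => trivial, fun _ _ => trivial⟩,
      fun _ _ => Or.inl trivial, Set.subset_univ _, Set.disjoint_empty _⟩
  let _ : DistribLattice B := DistribLattice.ofInfSupLe fun x y z => (hdm.inf_sup_distrib x y z).le
  have hF₀ : IsPFilter F₀.carrier := IsPFilter.of_def ⟨1, F₀.one_mem⟩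
    (fun x hx y hy => ⟨x ⊓ y, F₀.inf_mem hx hy, inf_le_left, inf_le_right⟩) F₀.mem_of_le
  have hI' : IsIdeal I := ⟨hI, hne, fun x hx y hy => ⟨x ⊔ y, hsup x hx y hy, le_sup_left,
    le_sup_right⟩⟩
  obtain ⟨P, hP, hIP, hFP⟩ := DistribLattice.prime_ideal_of_disjoint_filter_ideal
    (F := hF₀.toPFilter) (I := hI'.toIdeal) hd
  have hsub : ∀ x ∈ F₀.carrier, x ∉ P := fun x hx hxP => Set.disjoint_left.1 hFP hx hxP
  refine ⟨DeductiveFilter.ofInf hdm.le_mul_self (P : Set B)ᶜ (hsub 1 F₀.one_mem)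
    (fun hx hy h => (hP.mem_or_mem h).elim hx hy) (fun h hx hy => hx (P.lower h hy)),
    fun x y => ?_, hsub, ?_⟩
  · by_contra! h
    obtain ⟨h1, h2⟩ := h
    have h1 : imp x y ∈ P := not_not.1 h1
    have h2 : imp y x ∈ P := not_not.1 h2
    exact hsub 1 F₀.one_mem (P.lower (hB.one_le_imp_sup_imp x y) (P.sup_mem h1 h2))
  · exact Set.disjoint_left.2 fun x hx hxI => hx (hIP hxI)

end InvolutiveResiduatedLattice

/-! ### Reduction to chains -/

open InvolutiveResiduatedLattice in
theorem mainTheorem1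
    (K : (A : Type u) → [InvolutiveResiduatedLattice A] → Prop)
    (hK : IsVariety K)
    (hdm : ∀ (A : Type u) [InvolutiveResiduatedLattice A],
      K A → IsDeMorganMonoid A ∧ Semilinear A ∧ NegativelyGenerated A) :
    HasSurjectiveEpimorphisms K := by
  intro A B _ _ hA hB f hf
  refine Hom.surjective_of_negative (hdm B hB).2.2 fun b hb1 => ?_
  by_contra hb
  obtain ⟨hdB, hsB, -⟩ := hdm B hB
  have hs := hdB.le_mul_self
  obtain ⟨F, hF, hbF, hFI⟩ := exists_isLinear_disjoint hdB hsB
    (DeductiveFilter.ofInf hs {x | b ≤ x} hb1 le_inf fun h h' => le_trans h' h)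
    (I := {x | ∃ a, x ≤ f a ∧ f a ≤ b}) (fun x y h ⟨a, ha, hab⟩ => ⟨a, h.trans ha, hab⟩)
    (by
      rintro x ⟨a, ha, hab⟩ y ⟨a', ha', hab'⟩
      refine ⟨a ⊔ a', ?_, ?_⟩ <;> rw [f.map_sup]
      exacts [sup_le_sup ha ha', sup_le hab hab'])
    (Set.disjoint_left.2 fun x hx ⟨a, ha, hab⟩ => hb ⟨a, le_antisymm hab (le_trans hx ha)⟩)
  -- No image element of `F` is below `b`, so the filter generated by those elements can be extended
  -- without acquiring `b`.
  obtain ⟨G, hG, hFG, hGI⟩ := exists_isLinear_disjoint hdB hsB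
    (DeductiveFilter.ofInf hs {x | ∃ a, f a ∈ F.carrier ∧ f a ≤ x}
      ⟨1, by rw [f.map_one]; exact F.one_mem, by rw [f.map_one]⟩
      (by
        rintro x y ⟨a, ha, hax⟩ ⟨a', ha', hay⟩
        refine ⟨a ⊓ a', ?_, ?_⟩ <;> rw [f.map_inf]
        exacts [F.inf_mem ha ha', inf_le_inf hax hay])
      (fun h ⟨a, ha, hax⟩ => ⟨a, ha, hax.trans h⟩))
    (I := Set.Iic b) (isLowerSet_Iic b) (fun x hx y hy => sup_le hx hy)
    (Set.disjoint_left.2 fun x ⟨a, ha, hax⟩ hx =>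
      Set.disjoint_left.1 hFI ha ⟨a, le_rfl, hax.trans hx⟩)
  have hbF : b ∈ F.carrier := hbF le_rfl
  have hbG : b ∉ G.carrier := fun h => Set.disjoint_left.1 hGI h le_rfl
  have hsurj : Function.Surjective (F.proj.comp f) :=
    (hf.comp_of_surjective F.proj_surjective).surjective_of_chain hK hdm hF.total hA
      (hK.image B _ F.proj F.proj_surjective hB)
  have hle : ∀ a a', F.proj (f a) ≤ F.proj (f a') → G.proj (f a) ≤ G.proj (f a') := by
    intro a a' h
    rw [DeductiveFilter.proj_le, ← f.map_imp] at h ⊢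
    exact hFG ⟨_, h, le_rfl⟩
  have heq : ∀ a a', F.proj (f a) = F.proj (f a') → G.proj (f a) = G.proj (f a') :=
    fun a a' h => le_antisymm (hle a a' h.le) (hle a' a h.ge)
  have hex : ∀ u, ∃ a, F.proj (f a) = F.proj u := fun u => hsurj (F.proj u)
  choose s hs' using hex
  -- Replace `u` by an image element congruent to it modulo `F`, then project modulo `G`; by `heq`
  -- the choice does not matter.
  let g : Hom B G.Quot :=
    { toFun := fun u => G.proj (f (s u))
      map_mul := fun x y => by
        rw [← G.proj.map_mul, ← f.map_mul]
        apply heq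
        rw [hs', f.map_mul, F.proj.map_mul, F.proj.map_mul, hs', hs']
      map_inf := fun x y => by
        rw [← G.proj.map_inf, ← f.map_inf]
        apply heq
        rw [hs', f.map_inf, F.proj.map_inf, F.proj.map_inf, hs', hs']
      map_sup := fun x y => by
        rw [← G.proj.map_sup, ← f.map_sup]
        apply heq
        rw [hs', f.map_sup, F.proj.map_sup, F.proj.map_sup, hs', hs']
      map_neg := fun x => by
        rw [← G.proj.map_neg, ← f.map_neg]
        apply heq
        rw [hs', f.map_neg, F.proj.map_neg, F.proj.map_neg, hs']
      map_one := by
        rw [← G.proj.map_one, ← f.map_one]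
        apply heq
        rw [hs'] }
  have hgG : g = G.proj := hf _ (hK.image B _ G.proj G.proj_surjective hB) _ _
    (funext fun a => heq _ _ (hs' (f a)))
  apply hbG
  rw [← DeductiveFilter.one_le_proj, ← hgG, ← G.proj.map_one, ← f.map_one]
  apply hle
  rw [hs', f.map_one, F.proj.map_one]
  exact DeductiveFilter.one_le_proj.2 hbF
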